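/- Let a tensor of order $n$ be an $n$-linear form on Euclidean $\mathbb{R}^3$ (vectors being identified with tensors of order $1$ through the inner product). Let $g\in O(3)$ act by $(g\star T)(x_1,\dots,x_n)=T(g^{-1}x_1,\dots,g^{-1}x_n)$. Let $T^s=\frac1{n!}\sum_{\sigma}T(x_{\sigma(1)},\dots,x_{\sigma(n)})$ be the totally symmetric part of $T$, and $S\odot T=(S\otimes T)^s$. A dot, as in $T\cdot\nu$ or $\nu\cdot T$, denotes contraction with a vector in the last, respectively the first, slot. Let $\epsilon_{ijk}=\det(e_i,e_j,e_k)$ be the Levi-Civita tensor, and let $S\times T$ be the generalized cross product $$(S\times T)_{i_1\dots i_{p+q-1}}=\big(\epsilon_{i_1jk}\,S_{j i_2\dots i_p}\,T_{k i_{p+1}\dots i_{p+q-1}}\big)^s$$ of tensors of orders $p,q\ge 1$ (the usual cross product for $p=q=1$); repeated indices are summed over an orthonormal basis $(e_i)$, direct where $\epsilon$ occurs. Let $E$ be an elasticity tensor ($E_{ijkl}=E_{jikl}=E_{klij}$), $P$ a piezo-electricity tensor ($P_{ijk}=P_{ikj}$) and $\varepsilon$ a permittivity tensor ($\varepsilon_{ij}=\varepsilon_{ji}$).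 Put $d_{ij}=E_{kkij}$, $$h=\tfrac23(\epsilon:P)^s,\quad (\epsilon:P)_{ij}=\epsilon_{ikl}P_{klj},\qquad w=\tfrac34\big(\mathrm{tr}_{23}P-\mathrm{tr}(P^s)\big),$$ where $(\mathrm{tr}_{23}P)_i=P_{ikk}$ and $(\mathrm{tr}\,P^s)_i=(P^s)_{kki}$. Let $\nu$ be a unit vector, $s(\nu)=\mathrm{Id}-2\,\nu\otimes\nu$ the reflection across $\nu^\perp$, and $r(\nu,\pi)=-s(\nu)$ the rotation by $\pi$ about $\nu$. 1. $s(\nu)$ is a plane symmetry of the triple, i.e. $(s(\nu)\star E,\,s(\nu)\star P,\,s(\nu)\star\varepsilon)=(E,P,\varepsilon)$, if and only if $$\begin{cases}[E^s\cdot\nu-3\,\nu\odot(\nu\cdot E^s\cdot\nu)]\times\nu=0,\\ P^s\cdot\nu-2\,\nu\odot(\nu\cdot P^s\cdot\nu)=0,\\ (\varepsilon\cdot\nu)\times\nu=0,\\ (d\cdot\nu)\times\nu=0,\\ h-2\,\nu\odot(h\cdot\nu)=0,\\ w\cdot\nu=0.\end{cases}$$ 2. $r(\nu,\pi)$ is an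 axial symmetry of the triple, i.e. $(r(\nu,\pi)\star E,\,r(\nu,\pi)\star P,\,r(\nu,\pi)\star\varepsilon)=(E,P,\varepsilon)$, if and only if $$\begin{cases}[E^s\cdot\nu-3\,\nu\odot(\nu\cdot E^s\cdot\nu)]\times\nu=0,\\ [P^s-3\,\nu\odot(P^s\cdot\nu)]\times\nu=0,\\ (\varepsilon\cdot\nu)\times\nu=0,\\ (d\cdot\nu)\times\nu=0,\\ (h\cdot\nu)\times\nu=0,\\ w\times\nu=0.\end{cases}$$ -/

import Mathlib

noncomputable section

namespace Piezo

/-- Euclidean three-space `ℝ³`. -/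
abbrev V : Type := EuclideanSpace ℝ (Fin 3)

/-- Tensors of order `n`: the `n`-linear forms on `ℝ³`. -/
abbrev Tensor (n : ℕ) : Type := MultilinearMap ℝ (fun _ : Fin n => V) ℝ

/-- The canonical orthonormal basis of `ℝ³`. -/
def e (i : Fin 3) : V := EuclideanSpace.basisFun (Fin 3) ℝ i

/-- The action of `g ∈ O(3)`: `(g ⋆ T)(x₁, …, xₙ) = T(g⁻¹ x₁, …, g⁻¹ xₙ)`. -/
def star {n : ℕ} (g : V ≃ₗᵢ[ℝ] V) (T : Tensor n) : Tensor n :=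
  T.compLinearMap (fun _ => (g⁻¹).toLinearEquiv.toLinearMap)

theorem star_apply {n : ℕ} (g : V ≃ₗᵢ[ℝ] V) (T : Tensor n) (x : Fin n → V) :
    star g T x = T (fun i => g⁻¹ (x i)) := rfl

/-- The plane symmetry `s(ν)`: the orthogonal reflection across the plane orthogonal to `ν`. -/
def planeSym (ν : V) : V ≃ₗᵢ[ℝ] V := (Submodule.span ℝ {ν})ᗮ.reflection

/-- The transformation `r(ν, π) = -s(ν)`, the rotation of angle `π` around the axis `⟨ν⟩`. -/
def axialSym (ν : V) : V ≃ₗᵢ[ℝ] V := (planeSym ν).trans (LinearIsometryEquiv.neg ℝ)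

/-- `s(ν) = Id - 2 ν ⊗ ν` for a unit vector `ν`. -/
theorem planeSym_apply (ν : V) (hν : ‖ν‖ = 1) (x : V) :
    planeSym ν x = x - (2 * inner ℝ ν x) • ν := by
  rw [planeSym, Submodule.reflection_orthogonal_apply, Submodule.reflection_singleton_apply, hν]
  simp only [RCLike.ofReal_real_eq_id, id_eq, one_pow, div_one, neg_sub, mul_smul, two_smul]

theorem axialSym_apply (ν : V) (x : V) : axialSym ν x = -planeSym ν x := rfl

/-- The totally symmetric part `Tˢ`. -/
def symPart {n : ℕ} (T : Tensor n) : Tensor n :=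
  (1 / (n.factorial : ℝ)) • ∑ σ : Equiv.Perm (Fin n), T.domDomCongr σ

theorem symPart_apply {n : ℕ} (T : Tensor n) (x : Fin n → V) :
    symPart T x =
      (1 / (n.factorial : ℝ)) * ∑ σ : Equiv.Perm (Fin n), T (fun i => x (σ i)) := by
  simp [symPart]

/-- The tensor product `S ⊗ T`. -/
def tprod {p q : ℕ} (S : Tensor p) (T : Tensor q) : Tensor (p + q) :=
  ((LinearMap.mul' ℝ ℝ).compMultilinearMap (S.domCoprod T)).domDomCongr finSumFinEquiv

theorem tprod_apply {p q : ℕ} (S : Tensor p) (T : Tensor q) (x : Fin (p + q) → V) :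
    tprod S T x = S (fun i => x (Fin.castAdd q i)) * T (fun i => x (Fin.natAdd p i)) := by
  simp [tprod]

/-- The symmetric tensor product `S ⊙ T = (S ⊗ T)ˢ`. -/
def symProd {p q : ℕ} (S : Tensor p) (T : Tensor q) : Tensor (p + q) :=
  symPart (tprod S T)

/-- A vector regarded as a tensor of order `1`, through the inner product. -/
def vec (w : V) : Tensor 1 :=
  MultilinearMap.ofSubsingleton ℝ V ℝ (0 : Fin 1) (innerₗ V w)

theorem vec_apply (w : V) (x : Fin 1 → V) : vec w x = inner ℝ w (x 0) := rfl

/-- The contraction `T · w` in the last slot: `(T · w)_{i₁…iₙ} = T_{i₁…iₙj} w_j`. -/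
def contrR {n : ℕ} (T : Tensor (n + 1)) (w : V) : Tensor n :=
  (LinearMap.applyₗ w).compMultilinearMap (MultilinearMap.curryRight T)

theorem contrR_apply {n : ℕ} (T : Tensor (n + 1)) (w : V) (x : Fin n → V) :
    contrR T w x = T (Fin.snoc (α := fun _ => V) x w) := rfl

/-- The contraction `w · T` in the first slot: `(w · T)_{i₁…iₙ} = w_j T_{ji₁…iₙ}`. -/
def contrL {n : ℕ} (w : V) (T : Tensor (n + 1)) : Tensor n := T.curryLeft w

theorem contrL_apply {n : ℕ} (w : V) (T : Tensor (n + 1)) (x : Fin n → V) :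
    contrL w T x = T (Fin.cons (α := fun _ => V) w x) := rfl

/-- The trace over the first two indices: `(tr₁₂ T)_{i₁…iₙ} = T_{kki₁…iₙ}`. -/
def tr12 {n : ℕ} (T : Tensor (n + 2)) : Tensor n := ∑ k : Fin 3, contrL (e k) (contrL (e k) T)

/-- The trace over the last two indices of a third-order tensor: `(tr₂₃ T)ᵢ = Tᵢₖₖ`. -/
def tr23 (T : Tensor 3) : Tensor 1 := ∑ k : Fin 3, contrR (contrR T (e k)) (e k)

/-- The Levi-Civita tensor, `(x, y, z) ↦ det(x, y, z)`. -/
def leviCivita : Tensor 3 :=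
  ((EuclideanSpace.basisFun (Fin 3) ℝ).toBasis.det).toMultilinearMap

/-- `(ε : T)ᵢⱼ = εᵢₖₗ Tₖₗⱼ` for a third-order tensor `T`. -/
def leviCivitaContr (T : Tensor 3) : Tensor 2 :=
  ∑ k : Fin 3, ∑ l : Fin 3,
    tprod (contrR (contrR leviCivita (e l)) (e k)) (contrL (e l) (contrL (e k) T))

/-- The generalized cross product of `S` (order `p + 1`) and `T` (order `q + 1`):
the totally symmetric part of `ε_{i₁jk} S_{ji₂…} T_{k…}`, of order `1 + (p + q)`. -/
def cross {p q : ℕ} (S : Tensor (p + 1)) (T : Tensor (q + 1)) : Tensor (1 + (p + q)) :=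
  symPart (∑ j : Fin 3, ∑ k : Fin 3,
    tprod (contrR (contrR leviCivita (e k)) (e j)) (tprod (contrL (e j) S) (contrL (e k) T)))

/-- Elasticity tensors: `E_{ijkl} = E_{jikl} = E_{klij}`. -/
def Ela : Submodule ℝ (Tensor 4) where
  carrier := {E | ∀ x y z t : V, E ![x, y, z, t] = E ![y, x, z, t] ∧
    E ![x, y, z, t] = E ![z, t, x, y]}
  add_mem' := fun {a b} ha hb x y z t => by
    simp only [add_apply]
    exact ⟨by rw [(ha x y z t).1, (hb x y z t).1], by rw [(ha x y z t).2, (hb x y z t).2]⟩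
  zero_mem' := fun x y z t => by simp
  smul_mem' := fun c a ha x y z t => by
    simp only [smul_apply]
    exact ⟨by rw [(ha x y z t).1], by rw [(ha x y z t).2]⟩

/-- Piezo-electricity tensors: `P_{ijk} = P_{ikj}`. -/
def Piez : Submodule ℝ (Tensor 3) where
  carrier := {P | ∀ x y z : V, P ![x, y, z] = P ![x, z, y]}
  add_mem' := fun {a b} ha hb x y z => by
    simp only [add_apply]
    rw [ha x y z, hb x y z]
  zero_mem' := fun x y z => by simp
  smul_mem' := fun c a ha x y z => by
    simp only [smul_apply]
    rw [ha x y z]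

/-- Dielectric permittivity tensors: symmetric tensors of order `2`. -/
def Perm : Submodule ℝ (Tensor 2) where
  carrier := {a | ∀ x y : V, a ![x, y] = a ![y, x]}
  add_mem' := fun {a b} ha hb x y => by
    simp only [add_apply]
    rw [ha x y, hb x y]
  zero_mem' := fun x y => by simp
  smul_mem' := fun c a ha x y => by
    simp only [smul_apply]
    rw [ha x y]

/-- The dilatation tensor `d = tr₁₂ E`. -/
def dilatation (E : Tensor 4) : Tensor 2 := tr12 E

/-- The pseudo-tensor `h = (2/3) (ε : P)ˢ`. -/
def hPart (P : Tensor 3) : Tensor 2 := (2 / 3 : ℝ) • symPart (leviCivitaContr P)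

/-- The vector `w = (3/4) (tr₂₃ P - tr Pˢ)`, as a tensor of order `1`. -/
def wPart (P : Tensor 3) : Tensor 1 := (3 / 4 : ℝ) • (tr23 P - tr12 (symPart P))

/-- `g` is a symmetry of the triplet `(E, P, ε)`. -/
def IsSymmetry (g : V ≃ₗᵢ[ℝ] V) (E : Tensor 4) (P : Tensor 3) (ε : Tensor 2) : Prop :=
  (star g E, star g P, star g ε) = (E, P, ε)

end Piezo

end

noncomputable section

namespace Piezo

/-! Take an orthonormal basis `f` with `f 2 = ν`. Both transformations are diagonal in it with
entries ±1, so a tensor is invariant iff every component whose product of signs is -1 vanishes. For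
s(ν) these are the components with an odd number of indices 2. As r(ν,π) = -s(ν), they are the same
in even order (E and ε), and those with an even number of indices 2 for P.

The covariant conditions select the same components. For a symmetric tensor of order n, subtracting
n ν ⊙ (its contraction with ν) multiplies a component having m indices 2 by 1 - m, hence erases
exactly m = 1. The symmetrized cross product with ν is, up to a nonzero factor, the infinitesimal
rotation about ν: it kills powers of ν and is injective on forms of odd degree in the two other
coordinates.

This yields the vanishing of the required components of the symmetric parts; d, h and w supply the
equations that separate the components mixed by symmetrization. What remains is linear algebra on
finite arrays: `elasticity_components_iff`, `piezo_plane_components_iff`,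
`piezo_axial_components_iff` and `permittivity_components_iff`. -/

/-! ### Symmetrization in orders one to four -/

theorem symPart_one (T : Tensor 1) : symPart T = T := by
  ext x
  rw [symPart_apply]
  simp

theorem symPart_two (T : Tensor 2) (x y : V) :
    symPart T ![x, y] = (T ![x, y] + T ![y, x]) / 2 := by
  have key : ∀ σ : Equiv.Perm (Fin 2),
      T (fun i => ![x, y] (σ i)) = T ![![x, y] (σ 0), ![x, y] (σ 1)] := fun σ => by
    congr 1; ext i : 1; fin_cases i <;> rfl
  rw [symPart_apply]
  simp only [key]
  rw [← Equiv.sum_comp Equiv.Perm.decomposeFin.symm, Fintype.sum_prod_type]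
  simp [Fin.sum_univ_succ, Nat.factorial]
  ring

theorem symPart_three (T : Tensor 3) (x y z : V) :
    symPart T ![x, y, z] = (T ![x, y, z] + T ![x, z, y] + T ![y, x, z] + T ![y, z, x] +
      T ![z, x, y] + T ![z, y, x]) / 6 := by
  have key : ∀ σ : Equiv.Perm (Fin 3), T (fun i => ![x, y, z] (σ i)) =
      T ![![x, y, z] (σ 0), ![x, y, z] (σ 1), ![x, y, z] (σ 2)] := fun σ => by
    congr 1; ext i : 1; fin_cases i <;> rfl
  have huniv : (Finset.univ : Finset (Equiv.Perm (Fin 3))) =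
      {1, Equiv.swap 0 1, Equiv.swap 0 2, Equiv.swap 1 2, Equiv.swap 0 1 * Equiv.swap 1 2,
        Equiv.swap 1 2 * Equiv.swap 0 1} := by decide
  rw [symPart_apply]
  simp only [key, huniv]
  repeat rw [Finset.sum_insert (by decide)]
  rw [Finset.sum_singleton]
  simp [Nat.factorial, Equiv.swap_apply_def]
  ring

theorem symPart_of_mem_Piez {P : Tensor 3} (hP : P ∈ Piez) (x y z : V) :
    symPart P ![x, y, z] = (P ![x, y, z] + P ![y, x, z] + P ![z, x, y]) / 3 := by
  rw [symPart_three, hP x z y, hP y z x, hP z y x]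
  ring

theorem Ela_swap_right {E : Tensor 4} (hE : E ∈ Ela) (x y z t : V) :
    E ![x, y, z, t] = E ![x, y, t, z] := by
  rw [(hE x y z t).2, (hE z t x y).1, (hE t z x y).2]

/-- The index symmetries of E form a group of order 8, so the 24 permuted terms fall into three
classes, one for each splitting of the arguments into two pairs. -/
theorem symPart_of_mem_Ela {E : Tensor 4} (hE : E ∈ Ela) (x y z t : V) :
    symPart E ![x, y, z, t] =
      (E ![x, y, z, t] + E ![x, z, y, t] + E ![x, t, y, z]) / 3 := by
  have key : ∀ σ : Equiv.Perm (Fin 4), E (fun i => ![x, y, z, t] (σ i)) =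
      E ![![x, y, z, t] (σ 0), ![x, y, z, t] (σ (Fin.succ 0)),
        ![x, y, z, t] (σ (Fin.succ (Fin.succ 0))),
        ![x, y, z, t] (σ (Fin.succ (Fin.succ (Fin.succ 0))))] :=
    fun σ => by congr 1; ext i : 1; fin_cases i <;> rfl
  rw [symPart_apply]
  simp only [key]
  rw [← Equiv.sum_comp Equiv.Perm.decomposeFin.symm, Fintype.sum_prod_type]
  simp only [← Equiv.sum_comp (Equiv.Perm.decomposeFin (n := 2)).symm, Fintype.sum_prod_type,
    ← Equiv.sum_comp (Equiv.Perm.decomposeFin (n := 1)).symm,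
    Equiv.Perm.decomposeFin_symm_apply_zero, Equiv.Perm.decomposeFin_symm_apply_succ]
  simp [Fin.sum_univ_succ, Nat.factorial, Equiv.swap_apply_def]
  have h1 : ∀ a b c d, E ![a, b, c, d] = E ![b, a, c, d] := fun a b c d => (hE a b c d).1
  have h2 := Ela_swap_right hE
  have h3 : ∀ a b c d, E ![a, b, c, d] = E ![c, d, a, b] := fun a b c d => (hE a b c d).2
  -- Only order-decreasing instances are used, so that rewriting terminates: arguments are sorted
  -- inside each pair, then the pair containing `x` is put first.
  simp only [h1 y x, h1 z x, h1 z y, h1 t x, h1 t y, h1 t z]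
  simp only [h2 _ _ y x, h2 _ _ z x, h2 _ _ z y, h2 _ _ t x, h2 _ _ t y, h2 _ _ t z]
  simp only [h3 y z x t, h3 y t x z, h3 z t x y]
  ring

/-! ### Contractions, adapted bases and basis-independent traces -/

theorem contrR_two (T : Tensor 2) (w x : V) : contrR T w ![x] = T ![x, w] := by
  rw [contrR_apply]; congr 1; ext i : 1; fin_cases i <;> rfl

theorem contrR_three (T : Tensor 3) (w x y : V) : contrR T w ![x, y] = T ![x, y, w] := by
  rw [contrR_apply]; congr 1; ext i : 1; fin_cases i <;> rfl

theorem contrR_four (T : Tensor 4) (w x y z : V) : contrR T w ![x, y, z] = T ![x, y, z, w] := by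
  rw [contrR_apply]; congr 1; ext i : 1; fin_cases i <;> rfl

theorem contrL_vecCons {n : ℕ} (T : Tensor (n + 1)) (w : V) (x : Fin n → V) :
    contrL w T x = T (Matrix.vecCons w x) := rfl

theorem exists_orthonormalBasis_eq (ν : V) (hν : ‖ν‖ = 1) :
    ∃ f : OrthonormalBasis (Fin 3) ℝ V, f 2 = ν := by
  obtain ⟨f, hf⟩ := Orthonormal.exists_orthonormalBasis_extension_of_card_eq
    (𝕜 := ℝ) (E := V) (ι := Fin 3) (by simp) (v := fun _ => ν) (s := {2})
    ⟨fun _ => hν, fun i j hij => (hij (Subsingleton.elim i j)).elim⟩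
  exact ⟨f, hf 2 rfl⟩

/-- The trace of a bilinear form does not depend on the orthonormal basis; this carries every
summation over `e` to the adapted basis. -/
theorem sum_diagonal_eq (B : V →ₗ[ℝ] V →ₗ[ℝ] ℝ) (f : OrthonormalBasis (Fin 3) ℝ V) :
    ∑ k, B (e k) (e k) = ∑ k, B (f k) (f k) := by
  have h1 : ∀ k, B (e k) (e k) = ∑ i, ∑ j, inner ℝ (f i) (e k) * inner ℝ (f j) (e k) *
      B (f i) (f j) := fun k => by
    conv_lhs => rw [← f.sum_repr' (e k)]
    simp only [map_sum, map_smul, LinearMap.sum_apply, LinearMap.smul_apply, smul_eq_mul,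
      Finset.mul_sum]
    rw [Finset.sum_comm]
    exact Finset.sum_congr rfl fun i _ => Finset.sum_congr rfl fun j _ => by ring
  simp only [h1]
  rw [Finset.sum_comm]
  refine Finset.sum_congr rfl fun i _ => ?_
  rw [Finset.sum_comm]
  have h2 : ∀ j, ∑ k, inner ℝ (f i) (e k) * inner ℝ (f j) (e k) * B (f i) (f j) =
      inner ℝ (f i) (f j) * B (f i) (f j) := fun j => by
    rw [← Finset.sum_mul, ← (EuclideanSpace.basisFun (Fin 3) ℝ).sum_inner_mul_inner (f i) (f j)]
    simp only [real_inner_comm (f j)]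
    rfl
  simp [h2, orthonormal_iff_ite.1 f.orthonormal]

/-! ### The cross product with the axis -/

/-- The linear operator `x ↦ ν × x`, up to orientation: `x ↦ ∑ⱼ det(x, eⱼ, ν) eⱼ`. -/
def crossOp (ν x : V) : V := ∑ j, leviCivita ![x, e j, ν] • e j

theorem sum_inner_smul_e (v : V) : ∑ j, inner ℝ v (e j) • e j = v := by
  conv_rhs => rw [← (EuclideanSpace.basisFun (Fin 3) ℝ).sum_repr' v]
  exact Finset.sum_congr rfl fun j _ => by rw [real_inner_comm]; rfl

/-- Alternating 3-forms on a three-dimensional space are proportional to the determinant of any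
basis. The factor `leviCivita f` carries the orientation of `f`; only its being nonzero matters
later. -/
theorem leviCivita_eq (f : OrthonormalBasis (Fin 3) ℝ V) (x y z : V) :
    leviCivita ![x, y, z] = leviCivita f *
      (inner ℝ (f 0) x * inner ℝ (f 1) y * inner ℝ (f 2) z
        - inner ℝ (f 0) x * inner ℝ (f 1) z * inner ℝ (f 2) y
        - inner ℝ (f 0) y * inner ℝ (f 1) x * inner ℝ (f 2) z
        + inner ℝ (f 0) y * inner ℝ (f 1) z * inner ℝ (f 2) x
        + inner ℝ (f 0) z * inner ℝ (f 1) x * inner ℝ (f 2) y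
        - inner ℝ (f 0) z * inner ℝ (f 1) y * inner ℝ (f 2) x) := by
  have h := congrArg (fun A => A ![x, y, z])
    (AlternatingMap.eq_smul_basis_det f.toBasis (EuclideanSpace.basisFun (Fin 3) ℝ).toBasis.det)
  simp only [AlternatingMap.smul_apply, Module.Basis.det_apply f.toBasis, smul_eq_mul,
    Matrix.det_fin_three, Module.Basis.toMatrix_apply] at h
  simpa [leviCivita, OrthonormalBasis.repr_apply_apply] using h

theorem leviCivita_basis_ne_zero (f : OrthonormalBasis (Fin 3) ℝ V) : leviCivita f ≠ 0 := by
  have h := (EuclideanSpace.basisFun (Fin 3) ℝ).toBasis.isUnit_det f.toBasis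
  rw [OrthonormalBasis.coe_toBasis] at h
  exact h.ne_zero

theorem crossOp_basis_zero (f : OrthonormalBasis (Fin 3) ℝ V) :
    crossOp (f 2) (f 0) = leviCivita f • f 1 := by
  rw [crossOp, ← sum_inner_smul_e (f 1), Finset.smul_sum]
  refine Finset.sum_congr rfl fun j _ => ?_
  rw [leviCivita_eq f, smul_smul]
  simp

theorem crossOp_basis_one (f : OrthonormalBasis (Fin 3) ℝ V) :
    crossOp (f 2) (f 1) = (-leviCivita f) • f 0 := by
  rw [crossOp, ← sum_inner_smul_e (f 0), Finset.smul_sum]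
  refine Finset.sum_congr rfl fun j _ => ?_
  rw [leviCivita_eq f, smul_smul]
  simp

theorem crossOp_basis_two (f : OrthonormalBasis (Fin 3) ℝ V) : crossOp (f 2) (f 2) = 0 := by
  refine Finset.sum_eq_zero fun j _ => ?_
  rw [leviCivita_eq f]
  simp

/-- The tensor `(x, y) ↦ S(ν × x, y)` whose symmetrization is `S × ν`. -/
def crossAux {p : ℕ} (S : Tensor (p + 1)) (ν : V) : Tensor (1 + (p + 0)) :=
  ∑ j : Fin 3, ∑ k : Fin 3,
    tprod (contrR (contrR leviCivita (e k)) (e j)) (tprod (contrL (e j) S) (contrL (e k) (vec ν)))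

/-- Summing over `k` puts `ν` in the last slot of the determinant; linearity of `S` in its first
slot then absorbs the sum over `j` into `crossOp`. -/
theorem crossAux_apply {p : ℕ} (S : Tensor (p + 1)) (ν : V) (y : Fin (1 + (p + 0)) → V) :
    crossAux S ν y = S (Fin.cons (α := fun _ => V) (crossOp ν (y (Fin.castAdd (p + 0) 0)))
      (fun i => y (Fin.natAdd 1 (Fin.castAdd 0 i)))) := by
  set x := y (Fin.castAdd (p + 0) 0) with hx
  set t : Fin p → V := fun i => y (Fin.natAdd 1 (Fin.castAdd 0 i))
  have hlev : ∀ j k, contrR (contrR leviCivita (e k)) (e j) (fun i => y (Fin.castAdd (p + 0) i)) =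
      leviCivita ![x, e j, e k] := fun j k => by
    rw [← contrR_three, ← contrR_two]
    congr 1; ext i : 1; fin_cases i; rfl
  have hsum : ∀ j, ∑ k, leviCivita ![x, e j, e k] * inner ℝ ν (e k) =
      leviCivita ![x, e j, ν] := fun j => by
    have hupd : ∀ z, leviCivita ![x, e j, z] =
        leviCivita.toLinearMap ![x, e j, 0] 2 z := fun z => by
      rw [MultilinearMap.toLinearMap_apply]
      congr 1; ext i : 1; fin_cases i <;> simp
    conv_rhs => rw [← sum_inner_smul_e ν]
    simp only [hupd, map_sum, map_smul, smul_eq_mul]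
    exact Finset.sum_congr rfl fun k _ => mul_comm _ _
  have hS : ∀ v, S (Fin.cons (α := fun _ => V) v t) = S.curryLeft v t := fun v => rfl
  rw [hS, crossOp, map_sum, sum_apply]
  simp only [crossAux, sum_apply, tprod_apply, hlev]
  refine Finset.sum_congr rfl fun j _ => ?_
  rw [map_smul, smul_apply, ← hsum, smul_eq_mul, Finset.sum_mul]
  refine Finset.sum_congr rfl fun k _ => ?_
  rw [mul_assoc, mul_comm (inner ℝ ν (e k))]
  rfl

theorem cross_vec_one (S : Tensor 1) (ν x : V) :
    (cross (p := 0) (q := 0) S (vec ν) : Tensor 1) ![x] = S ![crossOp ν x] := by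
  have h : (cross (p := 0) (q := 0) S (vec ν) : Tensor 1) = crossAux (p := 0) S ν :=
    symPart_one _
  rw [h]
  refine (crossAux_apply (p := 0) S ν ![x]).trans ?_
  congr 1; ext i : 1; fin_cases i; rfl

theorem cross_vec_three (S : Tensor 3) (ν x y z : V) :
    (cross (p := 2) (q := 0) S (vec ν) : Tensor 3) ![x, y, z] =
      (S ![crossOp ν x, y, z] + S ![crossOp ν x, z, y] + S ![crossOp ν y, x, z] +
        S ![crossOp ν y, z, x] + S ![crossOp ν z, x, y] + S ![crossOp ν z, y, x]) / 6 := by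
  have h : ∀ u v w, (crossAux (p := 2) S ν : Tensor 3) ![u, v, w] =
      S ![crossOp ν u, v, w] := fun u v w => by
    refine (crossAux_apply (p := 2) S ν ![u, v, w]).trans ?_
    congr 1; ext i : 1; fin_cases i <;> rfl
  simp only [← h]
  exact symPart_three _ x y z

/-! ### Symmetric products with the axis, traces and the Levi-Civita contraction -/

theorem symProd_vec_one (ν : V) (T : Tensor 1) (x y : V) :
    (symProd (vec ν) T : Tensor 2) ![x, y] =
      (inner ℝ ν x * T ![y] + inner ℝ ν y * T ![x]) / 2 := by
  have h : ∀ u v, (tprod (vec ν) T : Tensor 2) ![u, v] = inner ℝ ν u * T ![v] := fun u v => by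
    refine (tprod_apply (vec ν) T ![u, v]).trans ?_
    congr 1; congr 1; ext i : 1; fin_cases i; rfl
  rw [← h, ← h]
  exact symPart_two _ x y

theorem symProd_vec_two (ν : V) (T : Tensor 2) (hT : ∀ u v, T ![u, v] = T ![v, u]) (x y z : V) :
    (symProd (vec ν) T : Tensor 3) ![x, y, z] =
      (inner ℝ ν x * T ![y, z] + inner ℝ ν y * T ![x, z] + inner ℝ ν z * T ![x, y]) / 3 := by
  have h : ∀ u v w, (tprod (vec ν) T : Tensor 3) ![u, v, w] = inner ℝ ν u * T ![v, w] :=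
    fun u v w => by
      refine (tprod_apply (vec ν) T ![u, v, w]).trans ?_
      congr 1; congr 1; ext i : 1; fin_cases i <;> rfl
  refine (symPart_three _ x y z).trans ?_
  simp only [h]
  rw [hT z y, hT z x, hT y x]
  ring

theorem tr12_apply (f : OrthonormalBasis (Fin 3) ℝ V) {n : ℕ} (T : Tensor (n + 2))
    (x : Fin n → V) :
    tr12 T x = ∑ k, T (Matrix.vecCons (f k) (Matrix.vecCons (f k) x)) := by
  rw [tr12, sum_apply]
  exact sum_diagonal_eq (LinearMap.mk₂ ℝ (fun u v => contrL v (contrL u T) x)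
    (by intros; simp only [contrL, map_add]; rfl)
    (by intros; simp only [contrL, map_smul]; rfl)
    (by intros; simp only [contrL, map_add, add_apply])
    (by intros; simp only [contrL, map_smul, smul_apply])) f

theorem tr23_apply (f : OrthonormalBasis (Fin 3) ℝ V) (T : Tensor 3) (x : V) :
    tr23 T ![x] = ∑ k, T ![x, f k, f k] := by
  rw [tr23, sum_apply]
  simp only [contrR_two, contrR_three]
  have h := tr12_apply f (contrL x T) ![]
  rw [tr12, sum_apply] at h
  exact h

theorem sum_mul_diagonal_eq (f : OrthonormalBasis (Fin 3) ℝ V) (a b : V →ₗ[ℝ] ℝ) :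
    ∑ k, a (e k) * b (e k) = ∑ k, a (f k) * b (f k) :=
  sum_diagonal_eq ((LinearMap.mul ℝ ℝ).compl₁₂ a b) f

theorem leviCivitaContr_apply (f : OrthonormalBasis (Fin 3) ℝ V) (T : Tensor 3) (x y : V) :
    leviCivitaContr T ![x, y] =
      ∑ k, ∑ l, leviCivita ![x, f k, f l] * T ![f k, f l, y] := by
  have h : ∀ k l, (tprod (contrR (contrR leviCivita (e l)) (e k))
      (contrL (e l) (contrL (e k) T)) : Tensor 2) ![x, y] =
      leviCivita ![x, e k, e l] * T ![e k, e l, y] := fun k l => by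
    rw [← contrR_three leviCivita, ← contrR_two (contrR leviCivita (e l))]
    refine (tprod_apply (p := 1) (q := 1) _ _ ![x, y]).trans ?_
    refine congrArg₂ (· * ·) (congrArg _ ?_) (congrArg T ?_) <;> ext i : 1
    · fin_cases i; rfl
    · fin_cases i <;> rfl
  have hL1 : ∀ (T : Tensor 3) (u w v : V), T ![u, v, w] = T.toLinearMap ![u, 0, w] 1 v :=
    fun T u w v => by
      rw [MultilinearMap.toLinearMap_apply]; congr 1; ext i : 1; fin_cases i <;> simp
  have hL2 : ∀ (T : Tensor 3) (u w v : V), T ![u, w, v] = T.toLinearMap ![u, w, 0] 2 v :=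
    fun T u w v => by
      rw [MultilinearMap.toLinearMap_apply]; congr 1; ext i : 1; fin_cases i <;> simp
  have hL0 : ∀ (T : Tensor 3) (u w v : V), T ![v, u, w] = T.toLinearMap ![0, u, w] 0 v :=
    fun T u w v => by
      rw [MultilinearMap.toLinearMap_apply]; congr 1; ext i : 1; fin_cases i <;> simp
  -- The basis is changed one summation index at a time: first `l` with `e k` fixed, then, after
  -- exchanging the sums, `k` with `f l` fixed.
  have h2 : ∀ k, ∑ l, leviCivita ![x, e k, e l] * T ![e k, e l, y] =
      ∑ l, leviCivita ![x, e k, f l] * T ![e k, f l, y] := fun k => by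
    simp only [hL2 leviCivita x (e k), hL1 T (e k) y]
    exact sum_mul_diagonal_eq f _ _
  have h1 : ∀ v, ∑ k, leviCivita ![x, e k, v] * T ![e k, v, y] =
      ∑ k, leviCivita ![x, f k, v] * T ![f k, v, y] := fun v => by
    simp only [hL1 leviCivita x v, hL0 T v y]
    exact sum_mul_diagonal_eq f _ _
  simp only [leviCivitaContr, sum_apply, h, h2]
  rw [Finset.sum_comm]
  simp only [h1]
  exact Finset.sum_comm

/-! ### Invariance under the symmetries in components -/

/-- The diagonal entries of `s(ν)` in an orthonormal basis whose last vector is `ν`. -/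
def planeSign : Fin 3 → ℝ := ![1, 1, -1]

theorem planeSym_basis (f : OrthonormalBasis (Fin 3) ℝ V) (i : Fin 3) :
    planeSym (f 2) (f i) = planeSign i • f i := by
  rw [planeSym_apply _ (f.orthonormal.1 2)]
  fin_cases i
  · simp [planeSign]
  · simp [planeSign]
  · simp only [planeSign, Fin.reduceFinMk, f.inner_eq_one]
    simp [two_smul]

theorem planeSym_inv (ν : V) : (planeSym ν)⁻¹ = planeSym ν :=
  Submodule.reflection_symm

theorem axialSym_inv (ν : V) : (axialSym ν)⁻¹ = axialSym ν := by
  refine inv_eq_of_mul_eq_one_left (LinearIsometryEquiv.ext fun x => ?_)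
  change -planeSym ν (-planeSym ν x) = x
  rw [map_neg, neg_neg]
  exact Submodule.reflection_reflection _ x

theorem tensor_ext_iff (f : OrthonormalBasis (Fin 3) ℝ V) {n : ℕ} {S T : Tensor n} :
    S = T ↔ ∀ v : Fin n → Fin 3, S (fun i => f (v i)) = T (fun i => f (v i)) := by
  refine ⟨fun h v => by rw [h], fun h => ?_⟩
  refine Module.Basis.ext_multilinear (fun _ => f.toBasis) fun v => ?_
  simpa using h v

/-- Multilinearity pulls the eigenvalues of g⁻¹ out of each slot, and a tensor is determined by its
components. -/
theorem star_eq_self_iff (f : OrthonormalBasis (Fin 3) ℝ V) {g : V ≃ₗᵢ[ℝ] V} {s : Fin 3 → ℝ}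
    (hs : ∀ i, g⁻¹ (f i) = s i • f i) {n : ℕ} (T : Tensor n) :
    star g T = T ↔ ∀ v : Fin n → Fin 3,
      (∏ i, s (v i)) * T (fun i => f (v i)) = T (fun i => f (v i)) := by
  rw [tensor_ext_iff f]
  simp only [star_apply, hs, MultilinearMap.map_smul_univ, smul_eq_mul]

theorem forall_fin_one {p : (Fin 1 → Fin 3) → Prop} : (∀ v, p v) ↔ ∀ i, p ![i] := by
  refine ⟨fun h i => h _, fun h v => ?_⟩
  have : v = ![v 0] := by ext i : 1; fin_cases i; rfl
  rw [this]; exact h _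

theorem forall_fin_two {p : (Fin 2 → Fin 3) → Prop} : (∀ v, p v) ↔ ∀ i j, p ![i, j] := by
  refine ⟨fun h i j => h _, fun h v => ?_⟩
  have : v = ![v 0, v 1] := by ext i : 1; fin_cases i <;> rfl
  rw [this]; exact h _ _

theorem forall_fin_three {p : (Fin 3 → Fin 3) → Prop} : (∀ v, p v) ↔ ∀ i j k, p ![i, j, k] := by
  refine ⟨fun h i j k => h _, fun h v => ?_⟩
  have : v = ![v 0, v 1, v 2] := by ext i : 1; fin_cases i <;> rfl
  rw [this]; exact h _ _ _

theorem forall_fin_four {p : (Fin 4 → Fin 3) → Prop} :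
    (∀ v, p v) ↔ ∀ i j k l, p ![i, j, k, l] := by
  refine ⟨fun h i j k l => h _, fun h v => ?_⟩
  have : v = ![v 0, v 1, v 2, v 3] := by ext i : 1; fin_cases i <;> rfl
  rw [this]; exact h _ _ _ _

theorem comp_vec_one (f : Fin 3 → V) (i : Fin 3) : (fun a => f (![i] a)) = ![f i] := by
  ext a : 1; fin_cases a; rfl

theorem comp_vec_two (f : Fin 3 → V) (i j : Fin 3) :
    (fun a => f (![i, j] a)) = ![f i, f j] := by
  ext a : 1; fin_cases a <;> rfl

theorem comp_vec_three (f : Fin 3 → V) (i j k : Fin 3) :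
    (fun a => f (![i, j, k] a)) = ![f i, f j, f k] := by
  ext a : 1; fin_cases a <;> rfl

theorem comp_vec_four (f : Fin 3 → V) (i j k l : Fin 3) :
    (fun a => f (![i, j, k, l] a)) = ![f i, f j, f k, f l] := by
  ext a : 1; fin_cases a <;> rfl

theorem tensor_zero_eq_zero_iff (T : Tensor 0) : T = 0 ↔ T ![] = 0 := by
  refine ⟨fun h => by rw [h]; rfl, fun h => ?_⟩
  ext x
  rw [Subsingleton.elim x ![], h]; rfl

theorem tensor_one_eq_zero_iff (f : OrthonormalBasis (Fin 3) ℝ V) (T : Tensor 1) :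
    T = 0 ↔ ∀ i, T ![f i] = 0 := by
  rw [tensor_ext_iff f, forall_fin_one]
  simp only [comp_vec_one, zero_apply]

theorem tensor_two_eq_zero_iff (f : OrthonormalBasis (Fin 3) ℝ V) (T : Tensor 2) :
    T = 0 ↔ ∀ i j, T ![f i, f j] = 0 := by
  rw [tensor_ext_iff f, forall_fin_two]
  simp only [comp_vec_two, zero_apply]

theorem tensor_three_eq_zero_iff (f : OrthonormalBasis (Fin 3) ℝ V) (T : Tensor 3) :
    T = 0 ↔ ∀ i j k, T ![f i, f j, f k] = 0 := by
  rw [tensor_ext_iff f, forall_fin_three]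
  simp only [comp_vec_three, zero_apply]

theorem star_two_eq_self_iff (f : OrthonormalBasis (Fin 3) ℝ V) {g : V ≃ₗᵢ[ℝ] V}
    {s : Fin 3 → ℝ} (hs : ∀ i, g⁻¹ (f i) = s i • f i) (T : Tensor 2) :
    star g T = T ↔ ∀ i j, s i * s j * T ![f i, f j] = T ![f i, f j] := by
  rw [star_eq_self_iff f hs, forall_fin_two]
  simp only [comp_vec_two, Fin.prod_univ_two]
  rfl

theorem star_three_eq_self_iff (f : OrthonormalBasis (Fin 3) ℝ V) {g : V ≃ₗᵢ[ℝ] V}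
    {s : Fin 3 → ℝ} (hs : ∀ i, g⁻¹ (f i) = s i • f i) (T : Tensor 3) :
    star g T = T ↔
      ∀ i j k, s i * s j * s k * T ![f i, f j, f k] = T ![f i, f j, f k] := by
  rw [star_eq_self_iff f hs, forall_fin_three]
  simp only [comp_vec_three, Fin.prod_univ_three]
  rfl

theorem star_four_eq_self_iff (f : OrthonormalBasis (Fin 3) ℝ V) {g : V ≃ₗᵢ[ℝ] V}
    {s : Fin 3 → ℝ} (hs : ∀ i, g⁻¹ (f i) = s i • f i) (T : Tensor 4) :
    star g T = T ↔ ∀ i j k l,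
      s i * s j * s k * s l * T ![f i, f j, f k, f l] = T ![f i, f j, f k, f l] := by
  rw [star_eq_self_iff f hs, forall_fin_four]
  simp only [comp_vec_four, Fin.prod_univ_four]
  rfl

theorem planeSym_inv_basis (f : OrthonormalBasis (Fin 3) ℝ V) (i : Fin 3) :
    (planeSym (f 2))⁻¹ (f i) = planeSign i • f i := by
  rw [planeSym_inv, planeSym_basis]

theorem axialSym_inv_basis (f : OrthonormalBasis (Fin 3) ℝ V) (i : Fin 3) :
    (axialSym (f 2))⁻¹ (f i) = (-planeSign i) • f i := by
  rw [axialSym_inv, axialSym_apply, planeSym_basis, neg_smul]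

/-! ### Vanishing of cross products in components -/

/-- The nonzero matrix entries of `x ↦ ν × x` in an adapted basis, up to orientation. -/
def rotSign : Fin 3 → ℝ := ![1, -1, 0]

/-- The index permutation underlying `x ↦ ν × x` in an adapted basis. -/
def rotIndex : Fin 3 → Fin 3 := ![1, 0, 2]

/-- A quarter turn of the plane orthogonal to the axis, up to orientation. The value of `rotIndex`
at 2 is immaterial because `rotSign 2 = 0`. -/
theorem crossOp_basis (f : OrthonormalBasis (Fin 3) ℝ V) (i : Fin 3) :
    crossOp (f 2) (f i) = (leviCivita f * rotSign i) • f (rotIndex i) := by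
  fin_cases i
  · simp [rotSign, rotIndex, crossOp_basis_zero]
  · simp [rotSign, rotIndex, crossOp_basis_one]
  · simp [rotSign, rotIndex, crossOp_basis_two]

theorem vecCons_smul {n : ℕ} (T : Tensor (n + 1)) (c : ℝ) (u : V) (x : Fin n → V) :
    T (Matrix.vecCons (c • u) x) = c * T (Matrix.vecCons u x) :=
  T.cons_smul x c u

theorem cross_one_eq_zero_iff (f : OrthonormalBasis (Fin 3) ℝ V) (S : Tensor 1) :
    cross (p := 0) (q := 0) S (vec (f 2)) = 0 ↔
      ∀ i, rotSign i * S ![f (rotIndex i)] = 0 := by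
  refine (tensor_one_eq_zero_iff f _).trans (forall_congr' fun i => ?_)
  rw [cross_vec_one, crossOp_basis, vecCons_smul, mul_assoc,
    mul_eq_zero_iff_left (leviCivita_basis_ne_zero f)]

theorem cross_three_eq_zero_iff (f : OrthonormalBasis (Fin 3) ℝ V) (S : Tensor 3) :
    cross (p := 2) (q := 0) S (vec (f 2)) = 0 ↔ ∀ i j k,
      rotSign i * (S ![f (rotIndex i), f j, f k] + S ![f (rotIndex i), f k, f j]) +
      rotSign j * (S ![f (rotIndex j), f i, f k] + S ![f (rotIndex j), f k, f i]) +
      rotSign k * (S ![f (rotIndex k), f i, f j] + S ![f (rotIndex k), f j, f i]) = 0 := by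
  refine (tensor_three_eq_zero_iff f _).trans
    (forall_congr' fun i => forall_congr' fun j => forall_congr' fun k => ?_)
  rw [cross_vec_three]
  simp only [crossOp_basis, vecCons_smul]
  rw [div_eq_zero_iff, or_iff_left (by norm_num)]
  refine Iff.trans ?_ (mul_eq_zero_iff_left (leviCivita_basis_ne_zero f))
  refine Eq.congr_left ?_
  ring

/-- The components of the vector `ν` in an adapted basis. -/
def axisCoord : Fin 3 → ℝ := ![0, 0, 1]

theorem inner_axis_basis (f : OrthonormalBasis (Fin 3) ℝ V) (i : Fin 3) :
    inner ℝ (f 2) (f i) = axisCoord i := by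
  fin_cases i <;> simp [axisCoord]

/-! ### Linear algebra of the component arrays -/

/-- An elasticity-type array has vanishing components with an odd number of indices `2` iff its
symmetric part and its trace satisfy the corresponding rotational conditions. -/
theorem elasticity_components_iff (A : Fin 3 → Fin 3 → Fin 3 → Fin 3 → ℝ)
    (h1 : ∀ i j k l, A i j k l = A j i k l) (h2 : ∀ i j k l, A i j k l = A k l i j)
    (B : Fin 3 → Fin 3 → Fin 3 → Fin 3 → ℝ)
    (hB : ∀ i j k l, B i j k l = (A i j k l + A i k j l + A i l j k) / 3)
    (C : Fin 3 → Fin 3 → Fin 3 → ℝ)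
    (hC : ∀ i j k, C i j k = B i j k 2 -
      (axisCoord i * B 2 j k 2 + axisCoord j * B 2 i k 2 + axisCoord k * B 2 i j 2)) :
    (∀ i j k l, planeSign i * planeSign j * planeSign k * planeSign l * A i j k l = A i j k l) ↔
      (∀ i j k, rotSign i * (C (rotIndex i) j k + C (rotIndex i) k j) +
        rotSign j * (C (rotIndex j) i k + C (rotIndex j) k i) +
        rotSign k * (C (rotIndex k) i j + C (rotIndex k) j i) = 0) ∧
      ∀ i, rotSign i * ∑ a, A a a (rotIndex i) 2 = 0 := by
  have h3 : ∀ i j k l, A i j k l = A i j l k := fun i j k l => by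
    rw [h2, h1, h2]
  -- The symmetries are oriented as rewriting rules towards one normal form: indices increase inside
  -- each pair, and pairs are ordered 00, 11, 22, 01, 02, 12.
  have u0 := h1 1 0
  have u1 := h1 2 0
  have u2 := h1 2 1
  have v0 := fun i j => h3 i j 1 0
  have v1 := fun i j => h3 i j 2 0
  have v2 := fun i j => h3 i j 2 1
  have w0 := h2 1 1 0 0
  have w1 := h2 2 2 0 0
  have w2 := h2 2 2 1 1
  have w3 := h2 0 1 0 0
  have w4 := h2 0 1 1 1
  have w5 := h2 0 1 2 2
  have w6 := h2 0 2 0 0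
  have w7 := h2 0 2 1 1
  have w8 := h2 0 2 2 2
  have w9 := h2 0 2 0 1
  have w10 := h2 1 2 0 0
  have w11 := h2 1 2 1 1
  have w12 := h2 1 2 2 2
  have w13 := h2 1 2 0 1
  have w14 := h2 1 2 0 2
  constructor
  · intro h
    have hz : ∀ i j k l, planeSign i * planeSign j * planeSign k * planeSign l = -1 →
        A i j k l = 0 := fun i j k l hs => by
      have := h i j k l
      rw [hs] at this
      linarith
    constructor
    · intro i j k
      simp only [hC, hB]
      fin_cases i <;> fin_cases j <;> fin_cases k <;>
        simp [rotSign, rotIndex, axisCoord, hz, planeSign, u0, u1, u2, v0, v1, v2,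
        w1, w2, w5, w14] <;> ring
    · intro i
      fin_cases i <;> simp [rotSign, rotIndex, Fin.sum_univ_three, hz, planeSign]
  · rintro ⟨hc, hd⟩
    -- Eight equations for the eight independent components with an odd number of indices 2.
    have c000 := hc 0 0 0
    have c001 := hc 0 0 1
    have c011 := hc 0 1 1
    have c111 := hc 1 1 1
    have c022 := hc 0 2 2
    have c122 := hc 1 2 2
    have d0 := hd 0
    have d1 := hd 1
    clear hc hd
    simp only [hC, hB, Fin.sum_univ_three, rotSign, rotIndex, axisCoord, Matrix.cons_val,
      zero_mul, one_mul, neg_mul, add_zero, zero_add, sub_zero, u0, u1, u2, v0, v1, v2,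
        w1, w2, w6, w7, w8, w9, w10, w11, w12, w13, w14]
      at c000 c001 c011 c111 c022 c122 d0 d1
    -- The order matters, as earlier zeros feed later steps. The symmetric part only controls sums
    -- such as A 0 0 1 2 + 2 A 0 1 0 2; the trace equations `d0` and `d1` separate the two terms.
    have z1 : A 2 2 0 2 = 0 := by linarith
    have z2 : A 2 2 1 2 = 0 := by linarith
    have z3 : A 0 0 0 2 = 0 := by linarith
    have z4 : A 1 1 1 2 = 0 := by linarith
    have z5 : A 0 0 1 2 = 0 := by linarith
    have z6 : A 1 1 0 2 = 0 := by linarith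
    have z7 : A 0 1 0 2 = 0 := by linarith
    have z8 : A 0 1 1 2 = 0 := by linarith
    intro i j k l
    fin_cases i <;> fin_cases j <;> fin_cases k <;> fin_cases l <;>
      simp [planeSign, z1, z2, z3, z4, z5, z6, z7, z8, u0, u1, u2, v0, v1, v2,
        w0, w1, w2, w3, w4, w5, w6, w7, w8, w9, w10, w11, w12, w13, w14]

/-- A piezoelectricity-type array has vanishing components with an odd number of indices `2` iff
its symmetric part, pseudo-tensor part and vector part satisfy the plane conditions. -/
theorem piezo_plane_components_iff (p : Fin 3 → Fin 3 → Fin 3 → ℝ)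
    (hp : ∀ i j k, p i j k = p i k j) (q : Fin 3 → Fin 3 → Fin 3 → ℝ)
    (hq : ∀ i j k, q i j k = (p i j k + p j i k + p k i j) / 3)
    (h : Fin 3 → Fin 3 → ℝ)
    (hh : ∀ j, h 0 j = p 1 2 j - p 2 1 j ∧ h 1 j = p 2 0 j - p 0 2 j ∧ h 2 j = p 0 1 j - p 1 0 j) :
    (∀ i j k, planeSign i * planeSign j * planeSign k * p i j k = p i j k) ↔
      (∀ i j, q i j 2 - (axisCoord i * q 2 j 2 + axisCoord j * q 2 i 2) = 0) ∧
      (∀ i j, (h i j + h j i) -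
        (axisCoord i * (h j 2 + h 2 j) + axisCoord j * (h i 2 + h 2 i)) = 0) ∧
      ∑ k, p 2 k k - ∑ k, q k k 2 = 0 := by
  have n0 := fun i => hp i 1 0
  have n1 := fun i => hp i 2 0
  have n2 := fun i => hp i 2 1
  have h0 := fun j => (hh j).1
  have h1 := fun j => (hh j).2.1
  have h2 := fun j => (hh j).2.2
  constructor
  · intro h
    have hz : ∀ i j k, planeSign i * planeSign j * planeSign k = -1 →
        p i j k = 0 := fun i j k hs => by
      have := h i j k
      rw [hs] at this
      linarith
    refine ⟨fun i j => ?_, fun i j => ?_, ?_⟩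
    · fin_cases i <;> fin_cases j <;> simp [axisCoord, hq, hz, planeSign, n1, n2] <;> ring
    · fin_cases i <;> fin_cases j <;> simp [axisCoord, h0, h1, h2, hz, planeSign, n0] <;> ring
    · simp [Fin.sum_univ_three, hq, hz, planeSign]
  · rintro ⟨hc, hd, hw⟩
    -- Eight equations for eight unknowns. The entry (2, 2) of h is not needed, since h is
    -- trace-free by the symmetry of P in its last two indices.
    have c00 := hc 0 0
    have c01 := hc 0 1
    have c11 := hc 1 1
    have c22 := hc 2 2
    have d00 := hd 0 0
    have d01 := hd 0 1
    have d11 := hd 1 1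
    simp only [axisCoord, h0, h1, h2, hq, Fin.sum_univ_three, Matrix.cons_val,
      zero_mul, one_mul, add_zero, sub_zero, n0, n1, n2]
      at c00 c01 c11 c22 d00 d01 d11 hw
    have z0 : p 2 2 2 = 0 := by linarith
    have z1 : p 2 0 0 = 0 := by linarith
    have z2 : p 2 1 1 = 0 := by linarith
    have z3 : p 0 0 2 = 0 := by linarith
    have z4 : p 1 1 2 = 0 := by linarith
    have z5 : p 0 1 2 = 0 := by linarith
    have z6 : p 1 0 2 = 0 := by linarith
    have z7 : p 2 0 1 = 0 := by linarith
    intro i j k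
    fin_cases i <;> fin_cases j <;> fin_cases k <;>
      simp [planeSign, n0, n1, n2, z0, z1, z2, z3, z4, z5, z6, z7]

/-- A piezoelectricity-type array has vanishing components with an even number of indices `2` iff
its symmetric part, pseudo-tensor part and vector part satisfy the axial conditions. -/
theorem piezo_axial_components_iff (p : Fin 3 → Fin 3 → Fin 3 → ℝ)
    (hp : ∀ i j k, p i j k = p i k j) (q : Fin 3 → Fin 3 → Fin 3 → ℝ)
    (hq : ∀ i j k, q i j k = (p i j k + p j i k + p k i j) / 3)
    (C : Fin 3 → Fin 3 → Fin 3 → ℝ)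
    (hC : ∀ i j k, C i j k = q i j k -
      (axisCoord i * q j k 2 + axisCoord j * q i k 2 + axisCoord k * q i j 2))
    (h : Fin 3 → Fin 3 → ℝ)
    (hh : ∀ j, h 0 j = p 1 2 j - p 2 1 j ∧ h 1 j = p 2 0 j - p 0 2 j ∧ h 2 j = p 0 1 j - p 1 0 j) :
    (∀ i j k, -planeSign i * -planeSign j * -planeSign k * p i j k = p i j k) ↔
      (∀ i j k, rotSign i * (C (rotIndex i) j k + C (rotIndex i) k j) +
        rotSign j * (C (rotIndex j) i k + C (rotIndex j) k i) +
        rotSign k * (C (rotIndex k) i j + C (rotIndex k) j i) = 0) ∧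
      (∀ i, rotSign i * (h (rotIndex i) 2 + h 2 (rotIndex i)) = 0) ∧
      ∀ i, rotSign i * (∑ k, p (rotIndex i) k k - ∑ k, q k k (rotIndex i)) = 0 := by
  have n0 := fun i => hp i 1 0
  have n1 := fun i => hp i 2 0
  have n2 := fun i => hp i 2 1
  have h0 := fun j => (hh j).1
  have h1 := fun j => (hh j).2.1
  have h2 := fun j => (hh j).2.2
  constructor
  · intro h
    have hz : ∀ i j k, planeSign i * planeSign j * planeSign k = 1 →
        p i j k = 0 := fun i j k hs => by
      have := h i j k
      rw [show -planeSign i * -planeSign j * -planeSign k =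
        -(planeSign i * planeSign j * planeSign k) by ring, hs] at this
      linarith
    refine ⟨fun i j k => ?_, fun i => ?_, fun i => ?_⟩
    · simp only [hC, hq]
      fin_cases i <;> fin_cases j <;> fin_cases k <;>
        simp [rotSign, rotIndex, axisCoord, hz, planeSign, n0, n1, n2] <;> ring
    · fin_cases i <;> simp [rotSign, rotIndex, h0, h1, h2, hz, planeSign]
    · fin_cases i <;> simp [rotSign, rotIndex, Fin.sum_univ_three, hq, hz, planeSign]
  · rintro ⟨hc, hd, hw⟩
    -- Ten equations for the ten independent components with an even number of indices 2.
    have c000 := hc 0 0 0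
    have c001 := hc 0 0 1
    have c011 := hc 0 1 1
    have c111 := hc 1 1 1
    have c022 := hc 0 2 2
    have c122 := hc 1 2 2
    have d0 := hd 0
    have d1 := hd 1
    have w0 := hw 0
    have w1 := hw 1
    simp only [rotSign, rotIndex, axisCoord, hC, h0, h1, h2, hq, Fin.sum_univ_three,
      Matrix.cons_val, zero_mul, one_mul, neg_mul, add_zero, zero_add, sub_zero, n0, n1, n2]
      at c000 c001 c011 c111 c022 c122 d0 d1 w0 w1
    have z0 : p 1 2 2 = 0 := by linarith
    have z1 : p 0 2 2 = 0 := by linarith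
    have z2 : p 2 1 2 = 0 := by linarith
    have z3 : p 2 0 2 = 0 := by linarith
    have z4 : p 0 0 0 = 0 := by linarith
    have z5 : p 1 1 1 = 0 := by linarith
    have z6 : p 0 0 1 = 0 := by linarith
    have z7 : p 1 0 0 = 0 := by linarith
    have z8 : p 0 1 1 = 0 := by linarith
    have z9 : p 1 0 1 = 0 := by linarith
    intro i j k
    fin_cases i <;> fin_cases j <;> fin_cases k <;>
      simp [planeSign, n0, n1, n2, z0, z1, z2, z3, z4, z5, z6, z7, z8, z9]

theorem permittivity_components_iff (a : Fin 3 → Fin 3 → ℝ) (ha : ∀ i j, a i j = a j i) :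
    (∀ i j, planeSign i * planeSign j * a i j = a i j) ↔
      ∀ i, rotSign i * a (rotIndex i) 2 = 0 := by
  have h0 := ha 0 2
  have h1 := ha 1 2
  simp only [Fin.forall_fin_succ, planeSign, rotSign, rotIndex]
  simp
  constructor
  · rintro ⟨h, h', -⟩
    constructor <;> linarith
  · rintro ⟨h, h'⟩
    refine ⟨?_, ?_, ?_, ?_⟩ <;> linarith

/-! ### From component arrays to the tensor conditions -/

theorem isSymmetry_iff {g : V ≃ₗᵢ[ℝ] V} {E : Tensor 4} {P : Tensor 3} {ε : Tensor 2} :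
    IsSymmetry g E P ε ↔ star g E = E ∧ star g P = P ∧ star g ε = ε := by
  simp only [IsSymmetry, Prod.mk.injEq]

theorem dilatation_apply (f : OrthonormalBasis (Fin 3) ℝ V) (E : Tensor 4) (x y : V) :
    dilatation E ![x, y] = ∑ a, E ![f a, f a, x, y] :=
  tr12_apply f E ![x, y]

theorem elasticity_planeSign_iff (f : OrthonormalBasis (Fin 3) ℝ V) {E : Tensor 4}
    (hE : E ∈ Ela) :
    (∀ i j k l, planeSign i * planeSign j * planeSign k * planeSign l *
      E ![f i, f j, f k, f l] = E ![f i, f j, f k, f l]) ↔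
      cross (p := 2) (q := 0) (contrR (symPart E) (f 2) - (3 : ℝ) •
        (symProd (vec (f 2)) (contrR (contrL (f 2) (symPart E)) (f 2)) : Tensor 3))
        (vec (f 2)) = 0 ∧
      cross (p := 0) (q := 0) (contrR (dilatation E) (f 2)) (vec (f 2)) = 0 := by
  rw [cross_three_eq_zero_iff, cross_one_eq_zero_iff]
  simp only [contrR_two, dilatation_apply f]
  refine elasticity_components_iff (fun i j k l => E ![f i, f j, f k, f l])
    (fun _ _ _ _ => (hE _ _ _ _).1) (fun _ _ _ _ => (hE _ _ _ _).2)
    (fun i j k l => symPart E ![f i, f j, f k, f l])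
    (fun _ _ _ _ => symPart_of_mem_Ela hE _ _ _ _)
    (fun i j k => (contrR (symPart E) (f 2) - (3 : ℝ) •
        (symProd (vec (f 2)) (contrR (contrL (f 2) (symPart E)) (f 2)) : Tensor 3))
        ![f i, f j, f k]) fun i j k => ?_
  have hT : ∀ u v, contrR (contrL (f 2) (symPart E)) (f 2) ![u, v] =
      symPart E ![f 2, u, v, f 2] := fun u v => by
    rw [contrR_three, contrL_vecCons]
  rw [sub_apply, smul_apply, contrR_four, symProd_vec_two, smul_eq_mul]
  · simp only [hT, inner_axis_basis]
    ring
  · intro u v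
    rw [hT, hT, symPart_of_mem_Ela hE, symPart_of_mem_Ela hE, Ela_swap_right hE _ (f 2) u v]
    ring

/-- The components of `ε : P`, up to orientation, in an orthonormal basis `f`. -/
def pseudoPart (f : Fin 3 → V) (P : Tensor 3) : Fin 3 → Fin 3 → ℝ :=
  ![fun j => P ![f 1, f 2, f j] - P ![f 2, f 1, f j],
    fun j => P ![f 2, f 0, f j] - P ![f 0, f 2, f j],
    fun j => P ![f 0, f 1, f j] - P ![f 1, f 0, f j]]

theorem leviCivitaContr_basis (f : OrthonormalBasis (Fin 3) ℝ V) (P : Tensor 3) (i j : Fin 3) :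
    leviCivitaContr P ![f i, f j] = leviCivita f * pseudoPart f P i j := by
  rw [leviCivitaContr_apply f]
  simp only [leviCivita_eq f, Fin.sum_univ_three]
  fin_cases i <;> simp [pseudoPart] <;> ring

theorem hPart_basis (f : OrthonormalBasis (Fin 3) ℝ V) (P : Tensor 3) (i j : Fin 3) :
    hPart P ![f i, f j] = leviCivita f / 3 * (pseudoPart f P i j + pseudoPart f P j i) := by
  rw [hPart, smul_apply, symPart_two, leviCivitaContr_basis, leviCivitaContr_basis, smul_eq_mul]
  ring

theorem wPart_apply (f : OrthonormalBasis (Fin 3) ℝ V) (P : Tensor 3) (x : V) :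
    wPart P ![x] = 3 / 4 * (∑ k, P ![x, f k, f k] - ∑ k, symPart P ![f k, f k, x]) := by
  rw [wPart, smul_apply, sub_apply, tr23_apply f, tr12_apply f, smul_eq_mul]

theorem piezo_planeSign_iff (f : OrthonormalBasis (Fin 3) ℝ V) {P : Tensor 3} (hP : P ∈ Piez) :
    (∀ i j k, planeSign i * planeSign j * planeSign k * P ![f i, f j, f k] =
      P ![f i, f j, f k]) ↔
      contrR (symPart P) (f 2) - (2 : ℝ) •
        (symProd (vec (f 2)) (contrR (contrL (f 2) (symPart P)) (f 2)) : Tensor 2) = 0 ∧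
      hPart P - (2 : ℝ) • (symProd (vec (f 2)) (contrR (hPart P) (f 2)) : Tensor 2) = 0 ∧
      contrR (wPart P) (f 2) = 0 := by
  -- The scalar relating h to the symmetrized `pseudoPart`: 2/3 from the definition, 1/2 from
  -- symmetrization, and the orientation factor.
  have hc : leviCivita f / 3 ≠ 0 := div_ne_zero (leviCivita_basis_ne_zero f) three_ne_zero
  rw [piezo_plane_components_iff (fun i j k => P ![f i, f j, f k]) (fun _ _ _ => hP _ _ _)
    (fun i j k => symPart P ![f i, f j, f k]) (fun _ _ _ => symPart_of_mem_Piez hP _ _ _)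
    (pseudoPart f P) (fun _ => ⟨rfl, rfl, rfl⟩), tensor_two_eq_zero_iff f, tensor_two_eq_zero_iff f,
    tensor_zero_eq_zero_iff]
  refine and_congr ?_ (and_congr ?_ ?_)
  · refine forall_congr' fun i => forall_congr' fun j => Eq.congr_left ?_
    rw [sub_apply, smul_apply, symProd_vec_one, contrR_three, contrR_two, contrR_two,
      contrL_vecCons, contrL_vecCons, inner_axis_basis, inner_axis_basis, smul_eq_mul]
    ring
  · refine forall_congr' fun i => forall_congr' fun j => ?_
    rw [sub_apply, smul_apply, symProd_vec_one, contrR_two, contrR_two,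
      inner_axis_basis, inner_axis_basis, smul_eq_mul, hPart_basis, hPart_basis, hPart_basis,
      ← mul_eq_zero_iff_left hc]
    refine Eq.congr_left ?_
    ring
  · have h : contrR (wPart P) (f 2) ![] = wPart P ![f 2] := by
      rw [contrR_apply]; congr 1; ext i : 1; fin_cases i; rfl
    rw [h, wPart_apply f, mul_eq_zero_iff_left (by norm_num)]

theorem piezo_neg_planeSign_iff (f : OrthonormalBasis (Fin 3) ℝ V) {P : Tensor 3}
    (hP : P ∈ Piez) :
    (∀ i j k, -planeSign i * -planeSign j * -planeSign k * P ![f i, f j, f k] =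
      P ![f i, f j, f k]) ↔
      cross (p := 2) (q := 0) (symPart P - (3 : ℝ) •
        (symProd (vec (f 2)) (contrR (symPart P) (f 2)) : Tensor 3)) (vec (f 2)) = 0 ∧
      cross (p := 0) (q := 0) (contrR (hPart P) (f 2)) (vec (f 2)) = 0 ∧
      cross (p := 0) (q := 0) (wPart P) (vec (f 2)) = 0 := by
  have hc : leviCivita f / 3 ≠ 0 := div_ne_zero (leviCivita_basis_ne_zero f) three_ne_zero
  rw [piezo_axial_components_iff (fun i j k => P ![f i, f j, f k]) (fun _ _ _ => hP _ _ _)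
    (fun i j k => symPart P ![f i, f j, f k]) (fun _ _ _ => symPart_of_mem_Piez hP _ _ _)
    (fun i j k => (symPart P - (3 : ℝ) •
        (symProd (vec (f 2)) (contrR (symPart P) (f 2)) : Tensor 3)) ![f i, f j, f k])
    ?_ (pseudoPart f P) (fun _ => ⟨rfl, rfl, rfl⟩), cross_three_eq_zero_iff,
    cross_one_eq_zero_iff, cross_one_eq_zero_iff]
  · refine and_congr Iff.rfl (and_congr ?_ ?_) <;> refine forall_congr' fun i => ?_
    · rw [contrR_two, hPart_basis, mul_left_comm, mul_eq_zero_iff_left hc]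
    · rw [wPart_apply f, mul_left_comm,
        mul_eq_zero_iff_left (show (3 / 4 : ℝ) ≠ 0 by norm_num)]
  · intro i j k
    rw [sub_apply, smul_apply, symProd_vec_two, smul_eq_mul]
    · simp only [contrR_three, inner_axis_basis]
      ring
    · intro u v
      rw [contrR_three, contrR_three, symPart_three, symPart_three]
      ring

theorem permittivity_planeSign_iff (f : OrthonormalBasis (Fin 3) ℝ V) {ε : Tensor 2}
    (hε : ε ∈ Perm) :
    (∀ i j, planeSign i * planeSign j * ε ![f i, f j] = ε ![f i, f j]) ↔
      cross (p := 0) (q := 0) (contrR ε (f 2)) (vec (f 2)) = 0 := by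
  rw [cross_one_eq_zero_iff]
  simp only [contrR_two]
  exact permittivity_components_iff (fun i j => ε ![f i, f j]) fun _ _ => hε _ _

end Piezo

end

theorem mainTheorem2 (E : Piezo.Tensor 4) (P : Piezo.Tensor 3) (ε : Piezo.Tensor 2)
    (hE : E ∈ Piezo.Ela) (hP : P ∈ Piezo.Piez) (hε : ε ∈ Piezo.Perm)
    (ν : Piezo.V) (hν : ‖ν‖ = 1) :
    (Piezo.IsSymmetry (Piezo.planeSym ν) E P ε ↔
      Piezo.cross
        (Piezo.contrR (Piezo.symPart E) ν - (3 : ℝ) •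
          (Piezo.symProd (Piezo.vec ν)
            (Piezo.contrR (Piezo.contrL ν (Piezo.symPart E)) ν) : Piezo.Tensor 3))
        (Piezo.vec ν) = 0 ∧
      Piezo.contrR (Piezo.symPart P) ν - (2 : ℝ) •
        (Piezo.symProd (Piezo.vec ν)
          (Piezo.contrR (Piezo.contrL ν (Piezo.symPart P)) ν) : Piezo.Tensor 2) = 0 ∧
      Piezo.cross (Piezo.contrR ε ν) (Piezo.vec ν) = 0 ∧
      Piezo.cross (Piezo.contrR (Piezo.dilatation E) ν) (Piezo.vec ν) = 0 ∧
      Piezo.hPart P - (2 : ℝ) •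
        (Piezo.symProd (Piezo.vec ν) (Piezo.contrR (Piezo.hPart P) ν) : Piezo.Tensor 2) = 0 ∧
      Piezo.contrR (Piezo.wPart P) ν = 0) ∧
    (Piezo.IsSymmetry (Piezo.axialSym ν) E P ε ↔
      Piezo.cross
        (Piezo.contrR (Piezo.symPart E) ν - (3 : ℝ) •
          (Piezo.symProd (Piezo.vec ν)
            (Piezo.contrR (Piezo.contrL ν (Piezo.symPart E)) ν) : Piezo.Tensor 3))
        (Piezo.vec ν) = 0 ∧
      Piezo.cross
        (Piezo.symPart P - (3 : ℝ) •
          (Piezo.symProd (Piezo.vec ν) (Piezo.contrR (Piezo.symPart P) ν) : Piezo.Tensor 3))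
        (Piezo.vec ν) = 0 ∧
      Piezo.cross (Piezo.contrR ε ν) (Piezo.vec ν) = 0 ∧
      Piezo.cross (Piezo.contrR (Piezo.dilatation E) ν) (Piezo.vec ν) = 0 ∧
      Piezo.cross (Piezo.contrR (Piezo.hPart P) ν) (Piezo.vec ν) = 0 ∧
      Piezo.cross (Piezo.wPart P) (Piezo.vec ν) = 0) := by
  obtain ⟨f, rfl⟩ := Piezo.exists_orthonormalBasis_eq ν hν
  have hs := Piezo.planeSym_inv_basis f
  have ha := Piezo.axialSym_inv_basis f
  constructor
  · rw [Piezo.isSymmetry_iff, Piezo.star_four_eq_self_iff f hs, Piezo.star_three_eq_self_iff f hs,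
      Piezo.star_two_eq_self_iff f hs, Piezo.elasticity_planeSign_iff f hE,
      Piezo.piezo_planeSign_iff f hP, Piezo.permittivity_planeSign_iff f hε]
    tauto
  · rw [Piezo.isSymmetry_iff, Piezo.star_four_eq_self_iff f ha, Piezo.star_three_eq_self_iff f ha,
      Piezo.star_two_eq_self_iff f ha, Piezo.piezo_neg_planeSign_iff f hP]
    -- In even order the signs of -s(ν) cancel, which reduces E and ε to the plane case. P has odd
    -- order, so it is treated before this simplification.
    simp only [mul_neg, neg_mul, neg_neg]
    rw [Piezo.elasticity_planeSign_iff f hE, Piezo.permittivity_planeSign_iff f hε]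
    tauto
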